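/- For $n\in\mathbb N=\{1,2,\dots\}$ and $s\in\mathbb R$ let $\widetilde\mu_n^{(s)}=\det(1+z^*z)^{-2n-s}\,dz$ on the space $\mathrm{Mat}(n,\mathbb C)$ of complex $n\times n$ matrices, where $dz$ is Lebesgue measure. Let $\mathrm{Mat}(\mathbb N,\mathbb C)$ be the space of infinite complex matrices $(z_{ij})_{i,j\in\mathbb N}$ with its Borel (product) $\sigma$-algebra, and let $\pi_n^\infty$ send an infinite matrix to its upper left $n\times n$ corner. For $s>-1$ the (finite) Pickrell measure $\mu^{(s)}$ is the unique probability measure on $\mathrm{Mat}(\mathbb N,\mathbb C)$ such that, for all $n\in\mathbb N$, $$(\pi_n^\infty)_*\mu^{(s)}=\pi^{-n^2}\prod_{l=1}^n\frac{\Gamma(2l+s)\,\Gamma(2l-1+s)}{\Gamma(l+s)^2}\;\widetilde\mu_n^{(s)} .$$ For $s\le-1$ let $n_0$ be the least $n\in\mathbb N$ with $n+s>0$. For $\lambda>0$, the (infinite) Pickrell measure $\mu^{(s)}=\mu^{(s,\lambda)}$ is the unique measure on $\mathrm{Mat}(\mathbb N,\mathbb C)$ such that, for all $n\in\mathbb N$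 with $n+s>0$, the set $(\pi_n^\infty)^{-1}(Y)$ has finite measure for every compact $Y\subset\mathrm{Mat}(n,\mathbb C)$, and $$(\pi_n^\infty)_*\mu^{(s,\lambda)}=\lambda\left(\prod_{l=n_0}^n\pi^{-(2l-1)}\,\frac{\Gamma(2l+s)\,\Gamma(2l-1+s)}{\Gamma(l+s)^2}\right)\widetilde\mu_n^{(s)} .$$ **Proposition.** For any $s_1,s_2\in\mathbb R$ with $s_1\ne s_2$, the Pickrell measures $\mu^{(s_1)}$ and $\mu^{(s_2)}$, each finite or infinite (and, in the infinite case, for any choice of $\lambda$), are mutually singular. -/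

import Mathlib

open MeasureTheory
open scoped ENNReal Matrix

noncomputable section

namespace Pickrell

/-- The space `Mat(n, ℂ)`, with the product (that is, Borel) σ-algebra and with Lebesgue measure
`volume`, the product of `n²` copies of the Lebesgue measure of `ℂ`. -/
abbrev Mat (n : ℕ) : Type := Fin n → Fin n → ℂ

/-- The space `Mat(ℕ, ℂ)` of infinite complex matrices, with the product (that is, Borel)
σ-algebra. Rows and columns are indexed from `0`. -/
abbrev InfMat : Type := ℕ → ℕ → ℂ

/-- The projection of an infinite matrix to its upper left `n × n` corner. -/
def corner (n : ℕ) (z : InfMat) : Mat n := fun i j => z i j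

/-- `det (1 + z* z)`; this determinant is real and positive, so that it equals its real part. -/
def detOnePlus {n : ℕ} (z : Mat n) : ℝ :=
  (Matrix.det (1 + (Matrix.of z)ᴴ * Matrix.of z)).re

/-- The measure `det (1 + z* z) ^ (-2n-s) dz` on `Mat(n, ℂ)`. -/
def unnormalized (n : ℕ) (s : ℝ) : Measure (Mat n) :=
  (volume : Measure (Mat n)).withDensity
    (fun z => ENNReal.ofReal (detOnePlus z ^ (-2 * (n : ℝ) - s)))

/-- The ratio `Γ(2l+s) Γ(2l-1+s) / Γ(l+s)²`. -/
def gammaRatio (s : ℝ) (l : ℕ) : ℝ :=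
  Real.Gamma (2 * (l : ℝ) + s) * Real.Gamma (2 * (l : ℝ) - 1 + s) / Real.Gamma ((l : ℝ) + s) ^ 2

/-- The normalization `π ^ (-n²) ∏_{l=1}^n Γ(2l+s) Γ(2l-1+s) / Γ(l+s)²` of the case `s > -1`. -/
def finiteConst (s : ℝ) (n : ℕ) : ℝ :=
  (Real.pi ^ (n ^ 2))⁻¹ * ∏ l ∈ Finset.Icc 1 n, gammaRatio s l

/-- The smallest positive integer `n₀` such that `n₀ + s > 0`. -/
def firstLevel (s : ℝ) : ℕ := sInf {n : ℕ | 1 ≤ n ∧ 0 < (n : ℝ) + s}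

/-- The normalization `∏_{l=n₀}^n π ^ (-(2l-1)) Γ(2l+s) Γ(2l-1+s) / Γ(l+s)²`
of the case `s ≤ -1`. -/
def infiniteConst (s : ℝ) (n : ℕ) : ℝ :=
  ∏ l ∈ Finset.Icc (firstLevel s) n, Real.pi ^ (-(2 * (l : ℝ) - 1)) * gammaRatio s l

/-- `μ` is the finite Pickrell measure `μ^(s)`, `s > -1`: the unique probability measure
on `Mat(ℕ, ℂ)` with the prescribed images on all corners. -/
structure IsFinitePickrellMeasure (s : ℝ) (μ : Measure InfMat) : Prop where
  neg_one_lt : -1 < s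
  isProbabilityMeasure : IsProbabilityMeasure μ
  map_corner : ∀ n : ℕ, 1 ≤ n →
    μ.map (corner n) = ENNReal.ofReal (finiteConst s n) • unnormalized n s

/-- `μ` is the infinite Pickrell measure `μ^(s, c)`, `s ≤ -1`, `c > 0`: the unique measure
on `Mat(ℕ, ℂ)` with the prescribed, locally finite, images on all sufficiently large corners. -/
structure IsInfinitePickrellMeasure (s c : ℝ) (μ : Measure InfMat) : Prop where
  le_neg_one : s ≤ -1
  pos : 0 < c
  lt_top_of_isCompact : ∀ n : ℕ, 1 ≤ n → 0 < (n : ℝ) + s →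
    ∀ Y : Set (Mat n), IsCompact Y → μ (corner n ⁻¹' Y) < ∞
  map_corner : ∀ n : ℕ, 1 ≤ n → 0 < (n : ℝ) + s →
    μ.map (corner n) = ENNReal.ofReal (c * infiniteConst s n) • unnormalized n s

/-- `μ` is a Pickrell measure with parameter `s`, finite or infinite; in the infinite case
it is only determined up to a positive factor. -/
def IsPickrellMeasure (s : ℝ) (μ : Measure InfMat) : Prop :=
  IsFinitePickrellMeasure s μ ∨ ∃ c : ℝ, IsInfinitePickrellMeasure s c μ

end Pickrell

end

/-!
The proof bounds the Hellinger affinities of the corner distributions. On the `n × n` corner the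
two Pickrell measures have the densities `k₁ det(1+z*z)^(-2n-s₁)` and `k₂ det(1+z*z)^(-2n-s₂)`. Their
geometric mean is again a density of this form, with parameter `m = (s₁ + s₂) / 2`, so that its
integral can be computed from the normalization constants.

* Hua's integral `lintegral_dropLast`: integrating `det(1+z*z)^(-2(n+1)-s)` over the last row and the
  last column gives a multiple of `det(1+z*z)^(-2n-s)`. Adding a row `v` replaces `A = 1 + z*z` by
  `A + v*v`, and the linear substitution `v = x B` with `A = B*B` reduces the integral over `v`
  to a radial one (`lintegral_det_add_vecMulVec`). A column is a row of the transpose. This holds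
  for every parameter with `n + 1 + s > 0`, in particular for `m`, and it needs no Pickrell measure
  with parameter `m`.
* Hence, when `n` grows by one to `l = n + 1`, the affinity over a fixed set of `N × N` corners is
  multiplied by `√(γ_l(s₁) γ_l(s₂)) / γ_l(m)`, where `γ_l(s) = Γ(2l+s) Γ(2l-1+s) / Γ(l+s)²`. With
  `d = (s₁ - s₂) / 2` and `g(k) = Γ(k+m+d) Γ(k+m-d) / Γ(k+m)²` the square of this factor is
  `g(2l) g(2l-1) / g(l)²`. Since `log g(k)` is of the exact order `1/k`, the product of these
  squares up to level `n`, which telescopes to a constant times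
  `∏_{n<k≤2n} g(k) / ∏_{N<k≤n} g(k)`, tends to zero (`tendsto_prod_gammaSecondDiff`).
* A measure below both Pickrell measures is bounded by twice the affinity at every level
  (`measure_preimage_corner_le_affinity`). It therefore vanishes on all matrices with `N × N` corner
  in a given ball, hence everywhere, and measures without a common nonzero minorant are mutually
  singular. Working over balls, where the affinity at level `N` is finite, treats finite and
  infinite measures alike, as soon as `N + s₁` and `N + s₂` are positive.
-/

noncomputable section

namespace Pickrell

open scoped ComplexOrder

/-! ### Radial integrals over `ℂ^k` -/

lemma lintegral_Ioi_mul_add_sq_rpow {c a : ℝ} (hc : 0 < c) (ha : 1 < a) :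
    ∫⁻ r in Set.Ioi (0 : ℝ), ENNReal.ofReal (r * (c + r ^ 2) ^ (-a)) =
      ENNReal.ofReal (c ^ (1 - a) / (2 * (a - 1))) := by
  have ha' : 0 < a - 1 := by linarith
  have hpos : ∀ x : ℝ, 0 < c + x ^ 2 := fun x => by positivity
  set g : ℝ → ℝ := fun r => -((c + r ^ 2) ^ (1 - a) / (2 * (a - 1))) with hg
  have hd : ∀ x : ℝ, HasDerivAt g (x * (c + x ^ 2) ^ (-a)) x := by
    intro x
    have h1 : HasDerivAt (fun r : ℝ => c + r ^ 2) (2 * x) x := by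
      simpa using (hasDerivAt_pow 2 x).const_add c
    have h2 := ((h1.rpow_const (p := 1 - a) (Or.inl (hpos x).ne')).div_const (2 * (a - 1))).neg
    refine h2.congr_deriv ?_
    rw [show 1 - a - 1 = -a by ring]
    field_simp
    ring
  have hlim : Filter.Tendsto g Filter.atTop (nhds 0) := by
    have h1 : Filter.Tendsto (fun r : ℝ => c + r ^ 2) Filter.atTop Filter.atTop :=
      Filter.tendsto_atTop_add_const_left _ _ (Filter.tendsto_pow_atTop two_ne_zero)
    have h2 := (tendsto_rpow_neg_atTop ha').comp h1
    have h3 := (h2.div_const (2 * (a - 1))).neg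
    simp only [zero_div, neg_zero] at h3
    refine h3.congr fun r => ?_
    simp [hg]
  have hcont : ContinuousWithinAt g (Set.Ici 0) 0 := (hd 0).continuousAt.continuousWithinAt
  have hnn : ∀ x ∈ Set.Ioi (0 : ℝ), 0 ≤ x * (c + x ^ 2) ^ (-a) := fun x hx =>
    mul_nonneg (le_of_lt hx) (Real.rpow_nonneg (hpos x).le _)
  have hint := integrableOn_Ioi_deriv_of_nonneg hcont (fun x _ => hd x) hnn hlim
  rw [← ofReal_integral_eq_lintegral_ofReal hint
    ((ae_restrict_iff' measurableSet_Ioi).2 (Filter.Eventually.of_forall hnn)),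
    integral_Ioi_of_hasDerivAt_of_tendsto hcont (fun x _ => hd x) hint hlim]
  simp [hg]

lemma lintegral_complex_add_normSq_rpow {c a : ℝ} (hc : 0 < c) (ha : 1 < a) :
    ∫⁻ w : ℂ, ENNReal.ofReal ((c + Complex.normSq w) ^ (-a)) =
      ENNReal.ofReal (Real.pi * c ^ (1 - a) / (a - 1)) := by
  rw [← Complex.lintegral_comp_polarCoord_symm]
  have h1 : ∀ p ∈ polarCoord.target,
      ENNReal.ofReal p.1 • ENNReal.ofReal ((c + Complex.normSq (Complex.polarCoord.symm p)) ^ (-a))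
        = ENNReal.ofReal (p.1 * (c + p.1 ^ 2) ^ (-a)) * 1 := by
    rintro p hp
    have hp0 : 0 < p.1 := by
      rw [polarCoord_target] at hp; exact hp.1
    rw [Complex.normSq_eq_norm_sq, Complex.norm_polarCoord_symm, sq_abs, smul_eq_mul, mul_one,
      ENNReal.ofReal_mul hp0.le]
  rw [setLIntegral_congr_fun polarCoord.open_target.measurableSet h1, polarCoord_target,
    Measure.volume_eq_prod, ← Measure.prod_restrict,
    lintegral_prod_mul (f := fun r : ℝ => ENNReal.ofReal (r * (c + r ^ 2) ^ (-a)))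
      (g := fun _ => 1) (by fun_prop) (by fun_prop),
    lintegral_Ioi_mul_add_sq_rpow hc ha]
  have ha' : 0 < a - 1 := by linarith
  simp only [lintegral_const, one_mul, Measure.restrict_apply_univ, Real.volume_Ioo]
  rw [← ENNReal.ofReal_mul (by positivity)]
  congr 1
  field_simp
  ring

/-- The value `π^k Γ(a-k) / Γ(a)` of the integral of `(1 + |x|²)^(-a)` over `ℂ^k`. -/
def radialConst (k : ℕ) (a : ℝ) : ℝ := Real.pi ^ k * Real.Gamma (a - k) / Real.Gamma a

lemma radialConst_pos {k : ℕ} {a : ℝ} (ha : (k : ℝ) < a) : 0 < radialConst k a := by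
  have h1 : 0 < Real.Gamma (a - k) := Real.Gamma_pos_of_pos (by linarith)
  have h2 : 0 < Real.Gamma a := Real.Gamma_pos_of_pos (lt_of_le_of_lt k.cast_nonneg ha)
  unfold radialConst
  positivity

lemma lintegral_pi_add_sum_normSq_rpow (k : ℕ) {c a : ℝ} (hc : 0 < c) (ha : (k : ℝ) < a) :
    ∫⁻ x : Fin k → ℂ, ENNReal.ofReal ((c + ∑ i, Complex.normSq (x i)) ^ (-a)) =
      ENNReal.ofReal (radialConst k a * c ^ ((k : ℝ) - a)) := by
  induction k generalizing c with
  | zero =>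
    have : Real.Gamma a ≠ 0 := (Real.Gamma_pos_of_pos (by simpa using ha)).ne'
    simp [radialConst, this, volume_pi]
  | succ k ih =>
    push_cast at ha
    have hm : Measurable fun p : ℂ × (Fin k → ℂ) =>
        ENNReal.ofReal ((c + Complex.normSq p.1 + ∑ i, Complex.normSq (p.2 i)) ^ (-a)) := by
      fun_prop
    have h1 := (volume_preserving_piFinSuccAbove (fun _ : Fin (k + 1) => ℂ) 0).lintegral_comp_emb
      (MeasurableEquiv.measurableEmbedding _) (fun p : ℂ × (Fin k → ℂ) =>
        ENNReal.ofReal ((c + Complex.normSq p.1 + ∑ i, Complex.normSq (p.2 i)) ^ (-a)))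
    rw [Measure.volume_eq_prod, lintegral_prod _ hm.aemeasurable] at h1
    have hin : ∀ w : ℂ, ∫⁻ y : Fin k → ℂ, ENNReal.ofReal
        ((c + Complex.normSq w + ∑ i, Complex.normSq (y i)) ^ (-a)) =
        ENNReal.ofReal (radialConst k a) *
          ENNReal.ofReal ((c + Complex.normSq w) ^ (-(a - k))) := by
      intro w
      rw [ih (c := c + Complex.normSq w) (by have := Complex.normSq_nonneg w; positivity)
        (by linarith), ENNReal.ofReal_mul (radialConst_pos (by linarith)).le, neg_sub]
    simp only [hin] at h1
    rw [lintegral_const_mul _ (by fun_prop), lintegral_complex_add_normSq_rpow hc (by linarith),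
      ← ENNReal.ofReal_mul (radialConst_pos (by linarith)).le] at h1
    refine Eq.trans (lintegral_congr fun x => ?_) (h1.trans (congrArg ENNReal.ofReal ?_))
    · rw [Fin.sum_univ_succ, ← add_assoc]
      rfl
    · have h3 : a - k - 1 ≠ 0 := by linarith
      have h2 : Real.Gamma (a - k) = (a - k - 1) * Real.Gamma (a - k - 1) := by
        rw [← Real.Gamma_add_one h3]; congr 1; ring
      unfold radialConst
      rw [h2]
      push_cast
      rw [show (1 : ℝ) - (a - k) = k + 1 - a by ring, show a - (k + 1 : ℝ) = a - k - 1 by ring]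
      field_simp
      ring

/-! ### Rank-one perturbations of a positive definite matrix -/

lemma map_vecMul_volume {n : ℕ} (B : Matrix (Fin n) (Fin n) ℂ) (hB : B.det ≠ 0) :
    (volume : Measure (Fin n → ℂ)).map (fun x => x ᵥ* B) =
      ENNReal.ofReal (Complex.normSq B.det)⁻¹ • volume := by
  have hdet : LinearMap.det ((Matrix.toLin' Bᵀ).restrictScalars ℝ) = Complex.normSq B.det := by
    rw [LinearMap.det_restrictScalars, LinearMap.det_toLin', Matrix.det_transpose,
      Algebra.norm_complex_apply]
  have h0 : 0 < Complex.normSq B.det := Complex.normSq_pos.2 hB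
  have h := Measure.map_linearMap_addHaar_eq_smul_addHaar (volume : Measure (Fin n → ℂ))
    (f := (Matrix.toLin' Bᵀ).restrictScalars ℝ) (by rw [hdet]; exact h0.ne')
  rw [hdet, abs_of_pos (inv_pos.2 h0)] at h
  rw [← h]
  congr 1
  ext x : 1
  simp [Matrix.mulVec_transpose]

lemma det_one_add_vecMulVec_star {n : ℕ} (x : Fin n → ℂ) :
    (1 + Matrix.vecMulVec (star x) x).det = ((1 + ∑ i, Complex.normSq (x i) : ℝ) : ℂ) := by
  rw [Matrix.vecMulVec_eq Unit, Matrix.det_one_add_mul_comm]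
  simp [Matrix.det_unique, Matrix.mul_apply, Complex.mul_conj]

/-- The integral of `det (A + v* v)^(-a)` over row vectors `v`; with `A = B* B`, the substitution
`v = x B` turns the integrand into `|det B|^(-2a) (1 + |x|²)^(-a)`. -/
lemma lintegral_det_add_vecMulVec {n : ℕ} {A : Matrix (Fin n) (Fin n) ℂ} (hA : A.PosDef)
    {a : ℝ} (ha : (n : ℝ) < a) :
    ∫⁻ v : Fin n → ℂ, ENNReal.ofReal ((A + Matrix.vecMulVec (star v) v).det.re ^ (-a)) =
      ENNReal.ofReal (radialConst n a * A.det.re ^ (1 - a)) := by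
  obtain ⟨B, hB⟩ : ∃ B : Matrix (Fin n) (Fin n) ℂ, A = Bᴴ * B := by
    open scoped MatrixOrder in
    exact CStarAlgebra.nonneg_iff_eq_star_mul_self.mp hA.posSemidef.nonneg
  set b : ℝ := Complex.normSq B.det with hb
  have hdet : A.det = (b : ℂ) := by
    rw [hB, Matrix.det_mul, Matrix.det_conjTranspose, hb, Complex.normSq_eq_conj_mul_self]
    rfl
  have hB0 : B.det ≠ 0 := by
    intro h
    have := hA.det_pos.ne'
    rw [hdet, hb, h] at this
    simp at this
  have hb0 : 0 < b := Complex.normSq_pos.2 hB0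
  have hre : A.det.re = b := by rw [hdet, Complex.ofReal_re]
  have key : ∀ x : Fin n → ℂ,
      (A + Matrix.vecMulVec (star (x ᵥ* B)) (x ᵥ* B)).det.re =
        b * (1 + ∑ i, Complex.normSq (x i)) := by
    intro x
    have h1 : A + Matrix.vecMulVec (star (x ᵥ* B)) (x ᵥ* B) =
        Bᴴ * (1 + Matrix.vecMulVec (star x) x) * B := by
      rw [Matrix.mul_add, Matrix.add_mul, Matrix.mul_one, ← hB, Matrix.mul_vecMulVec,
        Matrix.vecMulVec_mul, Matrix.star_vecMul]
    rw [h1, Matrix.det_mul, Matrix.det_mul, det_one_add_vecMulVec_star, Matrix.det_conjTranspose,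
      mul_right_comm, mul_comm (star _)]
    have : B.det * star B.det = (b : ℂ) := Complex.mul_conj _
    rw [this, ← Complex.ofReal_mul, Complex.ofReal_re]
  have hmeas : Measurable fun v : Fin n → ℂ =>
      ENNReal.ofReal ((A + Matrix.vecMulVec (star v) v).det.re ^ (-a)) := by
    have hc : Continuous fun v : Fin n → ℂ => (A + Matrix.vecMulVec (star v) v).det.re := by
      refine Complex.continuous_re.comp (Continuous.matrix_det ?_)
      exact continuous_const.add (Continuous.matrix_vecMulVec continuous_star continuous_id)
    exact (hc.measurable.pow_const _).ennreal_ofReal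
  have hvol : (volume : Measure (Fin n → ℂ)) =
      ENNReal.ofReal b • volume.map (fun x => x ᵥ* B) := by
    rw [map_vecMul_volume B hB0, smul_smul, ← ENNReal.ofReal_mul hb0.le, ← hb,
      mul_inv_cancel₀ hb0.ne', ENNReal.ofReal_one, one_smul]
  have hmB : Measurable fun x : Fin n → ℂ => x ᵥ* B :=
    (Continuous.matrix_vecMul continuous_id continuous_const).measurable
  rw [hvol, lintegral_smul_measure, lintegral_map hmeas hmB]
  have hin : ∀ x : Fin n → ℂ,
      ENNReal.ofReal ((A + Matrix.vecMulVec (star (x ᵥ* B)) (x ᵥ* B)).det.re ^ (-a)) =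
      ENNReal.ofReal (b ^ (-a)) *
        ENNReal.ofReal ((1 + ∑ i, Complex.normSq (x i)) ^ (-a)) := by
    intro x
    have hs : 0 ≤ 1 + ∑ i, Complex.normSq (x i) :=
      add_nonneg zero_le_one (Finset.sum_nonneg fun i _ => Complex.normSq_nonneg _)
    rw [key, Real.mul_rpow hb0.le hs, ENNReal.ofReal_mul (by positivity)]
  simp only [hin]
  rw [lintegral_const_mul _ (by fun_prop),
    lintegral_pi_add_sum_normSq_rpow n one_pos ha, smul_eq_mul, ← ENNReal.ofReal_mul (by positivity),
    ← ENNReal.ofReal_mul hb0.le, hre, Real.one_rpow, sub_eq_add_neg, Real.rpow_add hb0,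
    Real.rpow_one]
  congr 1
  ring

/-! ### Adding a row and a column -/

/-- `det (1 + X* X)` for a rectangular matrix `X`. -/
def rectDet {m n : ℕ} (X : Fin m → Fin n → ℂ) : ℝ :=
  (Matrix.det (1 + (Matrix.of X)ᴴ * Matrix.of X)).re

lemma posDef_one_add_conjTranspose_mul_self {m n : ℕ} (X : Matrix (Fin m) (Fin n) ℂ) :
    (1 + Xᴴ * X).PosDef :=
  Matrix.PosDef.one.add_posSemidef (Matrix.posSemidef_conjTranspose_mul_self X)

lemma rectDet_pos {m n : ℕ} (X : Fin m → Fin n → ℂ) : 0 < rectDet X :=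
  (Complex.pos_iff.1 (posDef_one_add_conjTranspose_mul_self (Matrix.of X)).det_pos).1

lemma rectDet_transpose {m n : ℕ} (X : Fin m → Fin n → ℂ) :
    rectDet (fun j i => X i j) = rectDet X := by
  have h : (1 + (Matrix.of fun j i => X i j)ᴴ * (Matrix.of fun j i => X i j)) =
      (1 + Matrix.of X * (Matrix.of X)ᴴ)ᵀ := by
    ext i j
    simp [Matrix.mul_apply, Matrix.one_apply, mul_comm, eq_comm]
  rw [rectDet, rectDet, h, Matrix.det_transpose, Matrix.det_one_add_mul_comm]

lemma continuous_rectDet {m n : ℕ} :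
    Continuous (rectDet : (Fin m → Fin n → ℂ) → ℝ) := by
  have hX : Continuous fun X : Fin m → Fin n → ℂ => Matrix.of X := continuous_id
  refine Complex.continuous_re.comp (Continuous.matrix_det ?_)
  exact continuous_const.add (hX.matrix_conjTranspose.matrix_mul hX)

lemma rectDet_append_row {m n : ℕ} (Z : Fin (m + 1) → Fin n → ℂ) :
    rectDet Z = (1 + (Matrix.of fun i : Fin m => Z i.castSucc)ᴴ *
      (Matrix.of fun i : Fin m => Z i.castSucc) +
      Matrix.vecMulVec (star (Z (Fin.last m))) (Z (Fin.last m))).det.re := by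
  rw [rectDet]
  congr 2
  ext i j
  simp [Matrix.mul_apply, Fin.sum_univ_castSucc, Matrix.vecMulVec_apply, add_assoc]

lemma lintegral_append_row {m n : ℕ} {a : ℝ} (ha : (n : ℝ) < a)
    {F : (Fin m → Fin n → ℂ) → ℝ≥0∞} (hF : Measurable F) :
    ∫⁻ Z : Fin (m + 1) → Fin n → ℂ,
        F (fun i => Z i.castSucc) * ENNReal.ofReal (rectDet Z ^ (-a)) =
      ENNReal.ofReal (radialConst n a) *
        ∫⁻ X : Fin m → Fin n → ℂ, F X * ENNReal.ofReal (rectDet X ^ (1 - a)) := by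
  have hc : Continuous fun p : (Fin n → ℂ) × (Fin m → Fin n → ℂ) =>
      (1 + (Matrix.of p.2)ᴴ * Matrix.of p.2 + Matrix.vecMulVec (star p.1) p.1).det.re := by
    have h2 : Continuous fun p : (Fin n → ℂ) × (Fin m → Fin n → ℂ) => Matrix.of p.2 :=
      continuous_snd
    refine Complex.continuous_re.comp (Continuous.matrix_det ?_)
    refine (continuous_const.add (h2.matrix_conjTranspose.matrix_mul h2)).add ?_
    exact Continuous.matrix_vecMulVec (continuous_star.comp continuous_fst) continuous_fst
  have hD : Measurable fun p : (Fin n → ℂ) × (Fin m → Fin n → ℂ) =>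
      F p.2 * ENNReal.ofReal ((1 + (Matrix.of p.2)ᴴ * Matrix.of p.2 +
        Matrix.vecMulVec (star p.1) p.1).det.re ^ (-a)) :=
    (hF.comp measurable_snd).mul (hc.measurable.pow_const _).ennreal_ofReal
  have h1 := (volume_preserving_piFinSuccAbove (fun _ : Fin (m + 1) => Fin n → ℂ)
    (Fin.last m)).lintegral_comp_emb (MeasurableEquiv.measurableEmbedding _)
    (fun p : (Fin n → ℂ) × (Fin m → Fin n → ℂ) =>
      F p.2 * ENNReal.ofReal ((1 + (Matrix.of p.2)ᴴ * Matrix.of p.2 +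
        Matrix.vecMulVec (star p.1) p.1).det.re ^ (-a)))
  rw [Measure.volume_eq_prod, lintegral_prod_symm _ hD.aemeasurable] at h1
  refine Eq.trans (lintegral_congr fun Z => ?_) (h1.trans ?_)
  · rw [rectDet_append_row]
    simp only [MeasurableEquiv.piFinSuccAbove_apply, Fin.insertNthEquiv_symm_apply,
      Fin.removeNth_last, Fin.init_def]
  · have hR : Measurable fun X : Fin m → Fin n → ℂ => F X * ENNReal.ofReal (rectDet X ^ (1 - a)) :=
      hF.mul (continuous_rectDet.measurable.pow_const _).ennreal_ofReal
    rw [← lintegral_const_mul _ hR]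
    refine lintegral_congr fun X => ?_
    have hX : Measurable fun v : Fin n → ℂ =>
        ENNReal.ofReal ((1 + (Matrix.of X)ᴴ * Matrix.of X +
          Matrix.vecMulVec (star v) v).det.re ^ (-a)) :=
      ((hc.comp (Continuous.prodMk_left X)).measurable.pow_const _).ennreal_ofReal
    dsimp only
    rw [lintegral_const_mul _ hX,
      lintegral_det_add_vecMulVec (posDef_one_add_conjTranspose_mul_self _) ha,
      ENNReal.ofReal_mul (radialConst_pos ha).le, mul_left_comm]
    rfl

/-- Transposition preserves Lebesgue measure. -/
lemma measurePreserving_swap (m n : ℕ) :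
    MeasurePreserving (fun (X : Fin m → Fin n → ℂ) (j : Fin n) (i : Fin m) => X i j) := by
  induction m with
  | zero =>
    refine ⟨by fun_prop, Measure.ext fun t _ => ?_⟩
    obtain rfl | rfl := Set.eq_empty_or_nonempty t |>.imp_right Set.Nonempty.eq_univ
    · simp
    rw [Measure.map_apply (by fun_prop) MeasurableSet.univ, Set.preimage_univ]
    simp [volume_pi, Measure.pi_univ]
  | succ m ih =>
    have h1 := volume_preserving_piFinSuccAbove (fun _ : Fin (m + 1) => Fin n → ℂ) 0
    have h2 := (MeasurePreserving.id (volume : Measure (Fin n → ℂ))).prod ih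
    have h3 := (volume_measurePreserving_arrowProdEquivProdArrow ℂ (Fin m → ℂ) (Fin n)).symm
    have h4 := volume_preserving_pi (fun _ : Fin n =>
      (volume_preserving_piFinSuccAbove (fun _ : Fin (m + 1) => ℂ) 0).symm)
    convert h4.comp (h3.comp (h2.comp h1)) using 1
    ext X j i
    refine Fin.cases ?_ (fun i => ?_) i <;> rfl

lemma lintegral_append_col {m n : ℕ} {a : ℝ} (ha : (m : ℝ) < a)
    {F : (Fin m → Fin n → ℂ) → ℝ≥0∞} (hF : Measurable F) :
    ∫⁻ Z : Fin m → Fin (n + 1) → ℂ,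
        F (fun i j => Z i j.castSucc) * ENNReal.ofReal (rectDet Z ^ (-a)) =
      ENNReal.ofReal (radialConst m a) *
        ∫⁻ X : Fin m → Fin n → ℂ, F X * ENNReal.ofReal (rectDet X ^ (1 - a)) := by
  have hm : ∀ b : ℝ, Measurable fun X : Fin m → Fin n → ℂ => F X * ENNReal.ofReal (rectDet X ^ b) :=
    fun b => hF.mul (continuous_rectDet.measurable.pow_const _).ennreal_ofReal
  have hm' : Measurable fun Z : Fin m → Fin (n + 1) → ℂ =>
      F (fun i j => Z i j.castSucc) * ENNReal.ofReal (rectDet Z ^ (-a)) :=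
    (hF.comp (by fun_prop)).mul (continuous_rectDet.measurable.pow_const _).ennreal_ofReal
  rw [← (measurePreserving_swap (n + 1) m).lintegral_comp hm',
    ← (measurePreserving_swap n m).lintegral_comp (hm _)]
  simp only [rectDet_transpose]
  exact lintegral_append_row ha (hF.comp (measurePreserving_swap n m).measurable)

/-- The upper left corner of a matrix of size `n + 1`. -/
def dropLast {n : ℕ} (Z : Mat (n + 1)) : Mat n := fun i j => Z i.castSucc j.castSucc

lemma measurable_dropLast {n : ℕ} : Measurable (dropLast (n := n)) := by
  unfold dropLast; fun_prop

/-- Hua's integral: integration over the last row and the last column. -/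
lemma lintegral_dropLast {n : ℕ} {s : ℝ} (hs : 0 < ((n + 1 : ℕ) : ℝ) + s)
    {F : Mat n → ℝ≥0∞} (hF : Measurable F) :
    ∫⁻ Z : Mat (n + 1), F (dropLast Z) *
        ENNReal.ofReal (detOnePlus Z ^ (-2 * ((n + 1 : ℕ) : ℝ) - s)) =
      ENNReal.ofReal (Real.pi ^ (2 * n + 1) / gammaRatio s (n + 1)) *
        ∫⁻ X : Mat n, F X * ENNReal.ofReal (detOnePlus X ^ (-2 * (n : ℝ) - s)) := by
  push_cast at hs
  set a : ℝ := 2 * n + 2 + s with ha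
  have h1 : ((n + 1 : ℕ) : ℝ) < a := by push_cast; linarith
  have h2 : (n : ℝ) < a - 1 := by linarith
  have hG : Measurable fun Y : Fin n → Fin (n + 1) → ℂ => F (fun i j => Y i j.castSucc) :=
    hF.comp (by fun_prop)
  have e1 := lintegral_append_row (m := n) h1 hG
  have e2 := lintegral_append_col h2 hF
  rw [neg_sub] at e2
  rw [e2, ← mul_assoc, ← ENNReal.ofReal_mul (radialConst_pos h1).le] at e1
  have x1 : -2 * ((n + 1 : ℕ) : ℝ) - s = -a := by push_cast; ring
  have x2 : -2 * (n : ℝ) - s = 1 - (a - 1) := by ring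
  rw [x1, x2]
  refine e1.trans ?_
  congr 2
  have g1 : 0 < Real.Gamma a := Real.Gamma_pos_of_pos (by linarith [n.cast_nonneg (α := ℝ)])
  have g2 : 0 < Real.Gamma (a - 1) := Real.Gamma_pos_of_pos (by linarith [n.cast_nonneg (α := ℝ)])
  have g3 : 0 < Real.Gamma (n + 1 + s) := Real.Gamma_pos_of_pos hs
  rw [radialConst, radialConst, gammaRatio]
  push_cast
  rw [show a - (n + 1) = n + 1 + s by ring, show a - 1 - n = n + 1 + s by ring,
    show 2 * ((n : ℝ) + 1) + s = a by ring, show 2 * ((n : ℝ) + 1) - 1 + s = a - 1 by ring]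
  field_simp
  ring

/-! ### Multiplicative second differences of the Gamma function -/

/-- The multiplicative second difference `Γ(x+d) Γ(x-d) / Γ(x)²`. -/
def gammaSecondDiff (d x : ℝ) : ℝ := Real.Gamma (x + d) * Real.Gamma (x - d) / Real.Gamma x ^ 2

lemma gammaSecondDiff_pos {d x : ℝ} (h : |d| < x) : 0 < gammaSecondDiff d x := by
  obtain ⟨h1, h2⟩ := abs_lt.1 h
  have g1 := Real.Gamma_pos_of_pos (show 0 < x + d by linarith)
  have g2 := Real.Gamma_pos_of_pos (show 0 < x - d by linarith)
  have g3 := Real.Gamma_pos_of_pos (show 0 < x by linarith)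
  unfold gammaSecondDiff
  positivity

/-- Log-convexity of `Γ`, applied to the points `x ± d` of the segment `[x - e, x + e]`. -/
lemma Gamma_mul_Gamma_le {d e x : ℝ} (hde : |d| ≤ e) (he : e < x) :
    Real.Gamma (x + d) * Real.Gamma (x - d) ≤ Real.Gamma (x + e) * Real.Gamma (x - e) := by
  obtain ⟨h1, h2⟩ := abs_le.1 hde
  have he0 : 0 ≤ e := (abs_nonneg d).trans hde
  rcases he0.eq_or_lt with h0 | h0
  · have : d = 0 := by linarith
    subst this; subst h0; rfl
  have p1 := Real.Gamma_pos_of_pos (show 0 < x + d by linarith)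
  have p2 := Real.Gamma_pos_of_pos (show 0 < x - d by linarith)
  have p3 := Real.Gamma_pos_of_pos (show 0 < x + e by linarith)
  have p4 := Real.Gamma_pos_of_pos (show 0 < x - e by linarith)
  set t : ℝ := (e + d) / (2 * e) with ht
  have ht0 : 0 ≤ t := by apply div_nonneg <;> linarith
  have ht1 : 0 ≤ 1 - t := by
    rw [ht, sub_nonneg, div_le_one (by linarith)]; linarith
  have hte : t * (2 * e) = e + d := by rw [ht]; field_simp
  have c1 := Real.convexOn_log_Gamma.2 (Set.mem_Ioi.2 (show 0 < x + e by linarith))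
    (Set.mem_Ioi.2 (show 0 < x - e by linarith)) ht0 ht1 (by ring)
  have c2 := Real.convexOn_log_Gamma.2 (Set.mem_Ioi.2 (show 0 < x - e by linarith))
    (Set.mem_Ioi.2 (show 0 < x + e by linarith)) ht0 ht1 (by ring)
  simp only [smul_eq_mul, Function.comp_apply] at c1 c2
  rw [show t * (x + e) + (1 - t) * (x - e) = x + d by linear_combination hte] at c1
  rw [show t * (x - e) + (1 - t) * (x + e) = x - d by linear_combination -hte] at c2
  rw [← Real.log_le_log_iff (by positivity) (by positivity), Real.log_mul p1.ne' p2.ne',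
    Real.log_mul p3.ne' p4.ne']
  linarith

lemma one_le_gammaSecondDiff {d x : ℝ} (h : |d| < x) : 1 ≤ gammaSecondDiff d x := by
  have g3 := Real.Gamma_pos_of_pos ((abs_nonneg d).trans_lt h)
  rw [gammaSecondDiff, one_le_div (by positivity)]
  rcases le_or_gt 0 d with hd | hd
  · have := Gamma_mul_Gamma_le (d := 0) (e := d) (x := x) (by simpa) (by rwa [abs_of_nonneg hd] at h)
    simpa [sq] using this
  · have := Gamma_mul_Gamma_le (d := 0) (e := -d) (x := x) (by simpa using hd.le)
      (by rwa [abs_of_neg hd] at h)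
    rw [sub_neg_eq_add, ← sub_eq_add_neg] at this
    simpa [sq, mul_comm] using this

lemma gammaSecondDiff_eq_mul {d x : ℝ} (h : |d| < x) :
    gammaSecondDiff d (x + 1) = gammaSecondDiff d x * (1 - d ^ 2 / x ^ 2) := by
  obtain ⟨h1, h2⟩ := abs_lt.1 h
  have hx : 0 < x := (abs_nonneg d).trans_lt h
  have g3 := Real.Gamma_pos_of_pos hx
  rw [gammaSecondDiff, gammaSecondDiff, show x + 1 + d = x + d + 1 by ring,
    show x + 1 - d = x - d + 1 by ring, Real.Gamma_add_one (by linarith),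
    Real.Gamma_add_one (by linarith), Real.Gamma_add_one hx.ne']
  field_simp
  ring

/-- Iterating `gammaSecondDiff_eq_mul` upwards, where each step increases the value by at least
`d² / (x+j)²` because `gammaSecondDiff` is at least `1`. -/
lemma one_add_sum_le_gammaSecondDiff {d x : ℝ} (h : |d| < x) (N : ℕ) :
    1 + ∑ j ∈ Finset.range N, d ^ 2 / (x + j) ^ 2 ≤ gammaSecondDiff d x := by
  have hx : 0 < x := (abs_nonneg d).trans_lt h
  induction N generalizing x with
  | zero => simpa using one_le_gammaSecondDiff h
  | succ N ih =>
    have h1 := ih (x := x + 1) (by linarith) (by linarith)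
    rw [gammaSecondDiff_eq_mul h] at h1
    have hQ := gammaSecondDiff_pos h
    have hQ1 := one_le_gammaSecondDiff h
    have hd : 0 ≤ d ^ 2 / x ^ 2 := by positivity
    rw [Finset.sum_range_succ']
    have h2 : ∑ j ∈ Finset.range N, d ^ 2 / (x + ((j + 1 : ℕ) : ℝ)) ^ 2 =
        ∑ j ∈ Finset.range N, d ^ 2 / (x + 1 + j) ^ 2 := by
      refine Finset.sum_congr rfl fun j _ => ?_
      push_cast; ring
    rw [h2]
    simp only [Nat.cast_zero, add_zero]
    nlinarith

/-- Summing `d² / (x+j)²` over about `x` terms gives a lower bound of the order of `1 / x`. -/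
lemma one_add_div_le_gammaSecondDiff {d x : ℝ} (h : |d| < x) (hx1 : 1 ≤ x) :
    1 + d ^ 2 / 9 / x ≤ gammaSecondDiff d x := by
  refine le_trans ?_ (one_add_sum_le_gammaSecondDiff h ⌈x⌉₊)
  have hx : 0 < x := by linarith
  have hN : x ≤ ⌈x⌉₊ := Nat.le_ceil x
  have hN' : (⌈x⌉₊ : ℝ) < x + 1 := Nat.ceil_lt_add_one hx.le
  gcongr
  calc d ^ 2 / 9 / x = x * (d ^ 2 / (3 * x) ^ 2) := by field_simp; norm_num
    _ ≤ ⌈x⌉₊ * (d ^ 2 / (3 * x) ^ 2) := by gcongr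
    _ = ∑ j ∈ Finset.range ⌈x⌉₊, d ^ 2 / (3 * x) ^ 2 := by simp
    _ ≤ _ := by
      refine Finset.sum_le_sum fun j hj => ?_
      have : (j : ℝ) < ⌈x⌉₊ := by exact_mod_cast Finset.mem_range.1 hj
      gcongr
      linarith

lemma Gamma_add_nat_le {x : ℝ} (hx : 0 < x) (K : ℕ) :
    Real.Gamma (x + K) ≤ (x + K) ^ K * Real.Gamma x := by
  induction K with
  | zero => simp
  | succ K ih =>
    have g := Real.Gamma_pos_of_pos hx
    push_cast
    rw [← add_assoc, Real.Gamma_add_one (by positivity), pow_succ', mul_assoc]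
    refine mul_le_mul (by linarith) (ih.trans ?_) (Real.Gamma_pos_of_pos (by positivity)).le
      (by positivity)
    exact mul_le_mul_of_nonneg_right (pow_le_pow_left₀ (by positivity) (by linarith) _) g.le

lemma pow_mul_Gamma_le {x : ℝ} (hx : 0 < x) (K : ℕ) :
    x ^ K * Real.Gamma x ≤ Real.Gamma (x + K) := by
  induction K with
  | zero => simp
  | succ K ih =>
    push_cast
    rw [← add_assoc, Real.Gamma_add_one (by positivity), pow_succ', mul_assoc]
    have g := Real.Gamma_pos_of_pos hx
    gcongr
    linarith [K.cast_nonneg (α := ℝ)]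

lemma gammaSecondDiff_le {d x : ℝ} {K : ℕ} (hd : |d| ≤ K) (hx : (K : ℝ) < x) :
    gammaSecondDiff d x ≤ ((x + K) / (x - K)) ^ K := by
  have hx0 : 0 < x := K.cast_nonneg.trans_lt hx
  have hxK : 0 < x - K := by linarith
  have g := Real.Gamma_pos_of_pos hx0
  have g' := Real.Gamma_pos_of_pos hxK
  have h1 := Gamma_mul_Gamma_le hd hx
  have h2 := Gamma_add_nat_le hx0 K
  have h3 := pow_mul_Gamma_le hxK K
  rw [sub_add_cancel] at h3
  rw [gammaSecondDiff, div_pow, div_le_div_iff₀ (by positivity) (by positivity)]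
  calc Real.Gamma (x + d) * Real.Gamma (x - d) * (x - K) ^ K
      ≤ Real.Gamma (x + K) * Real.Gamma (x - K) * (x - K) ^ K := by gcongr
    _ = Real.Gamma (x + K) * ((x - K) ^ K * Real.Gamma (x - K)) := by ring
    _ ≤ ((x + K) ^ K * Real.Gamma x) * Real.Gamma x := by gcongr
    _ = _ := by ring

/-! ### Decay of the affinities -/

/-- The products of `g(2l) g(2l-1) / g(l)²` tend to zero for `g(k) = gammaSecondDiff d (k + m)`:
they are at most `∏_{n<k≤2n} g(k) / ∏_{N<k≤n} g(k)`, whose numerator is bounded because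
`g(k) - 1` is at most of the order of `1/k`, and whose denominator diverges because `g(k) - 1` is
at least of the order of `1/k`. -/
lemma tendsto_prod_gammaSecondDiff {d m : ℝ} (hd : d ≠ 0) {N : ℕ} (hN : |d| < N + m) :
    Filter.Tendsto (fun n => ∏ l ∈ Finset.Ioc N n, (gammaSecondDiff d (2 * l + m) *
      gammaSecondDiff d (2 * l - 1 + m) / gammaSecondDiff d (l + m) ^ 2)) Filter.atTop (nhds 0) := by
  set g : ℕ → ℝ := fun k => gammaSecondDiff d (k + m) with hg
  have hlt : ∀ {k : ℕ}, N ≤ k → |d| < k + m := fun hk => by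
    have : (N : ℝ) ≤ _ := Nat.cast_le.2 hk
    linarith
  have hg1 : ∀ {k : ℕ}, N ≤ k → 1 ≤ g k := fun hk => one_le_gammaSecondDiff (hlt hk)
  have hg0 : ∀ {k : ℕ}, N ≤ k → 0 < g k := fun hk => gammaSecondDiff_pos (hlt hk)
  have hprod1 : ∀ a b : ℕ, N ≤ a → 1 ≤ ∏ k ∈ Finset.Ioc a b, g k := fun a _ hab =>
    Finset.prod_induction _ (1 ≤ ·) (fun _ _ => one_le_mul_of_one_le_of_one_le) le_rfl
      fun k hk => hg1 (hab.trans (Finset.mem_Ioc.1 hk).1.le)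
  -- only the values of `g` on `(n, 2n]` are not compensated by the factors `1 / g(l)²`
  have htel : ∀ n, N ≤ n → (∏ l ∈ Finset.Ioc N n, (gammaSecondDiff d (2 * l + m) *
      gammaSecondDiff d (2 * l - 1 + m) / gammaSecondDiff d (l + m) ^ 2)) *
      ((∏ k ∈ Finset.Ioc N (2 * N), g k) * ∏ k ∈ Finset.Ioc N n, g k) =
      ∏ k ∈ Finset.Ioc n (2 * n), g k := by
    intro n hn
    induction n, hn using Nat.le_induction with
    | base => simp
    | succ n hn ih =>
      rw [← Finset.insert_Ioc_right_eq_Ioc_add_one (by omega : N ≤ n),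
        Finset.prod_insert (by simp), Finset.prod_insert (by simp)]
      have e1 : (∏ k ∈ Finset.Ioc (n + 1) (2 * (n + 1)), g k) * g (n + 1) =
          (∏ k ∈ Finset.Ioc n (2 * n), g k) * g (2 * n + 1) * g (2 * n + 2) := by
        rw [← Finset.prod_Ioc_succ_top (by omega : n ≤ 2 * n),
          ← Finset.prod_Ioc_succ_top (by omega : n ≤ 2 * n + 1), mul_comm,
          ← Finset.prod_Ioc_consecutive g (Nat.le_succ n) (by omega : n + 1 ≤ 2 * n + 1 + 1)]
        simp [mul_add]
      have e2 : gammaSecondDiff d (2 * ((n + 1 : ℕ) : ℝ) + m) = g (2 * n + 2) := by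
        simp only [hg]; push_cast; ring_nf
      have e3 : gammaSecondDiff d (2 * ((n + 1 : ℕ) : ℝ) - 1 + m) = g (2 * n + 1) := by
        simp only [hg]; push_cast; ring_nf
      have hgn : g (n + 1) ≠ 0 := (hg0 (by omega)).ne'
      rw [e2, e3]
      change g (2 * n + 2) * g (2 * n + 1) / g (n + 1) ^ 2 * _ * _ = _
      rw [← mul_left_inj' hgn, e1, ← ih]
      field_simp
  -- for `k > n ≥ 2 (K - m)` one has `k + m - K ≥ n / 2`, so that each of the `n` factors is at most
  -- `(1 + 4 K / n) ^ K`
  obtain ⟨K, hK⟩ := exists_nat_ge |d|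
  obtain ⟨n₀, hn₀⟩ := exists_nat_ge (2 * (K - m))
  have hnum : ∀ n, N ≤ n → n₀ ≤ n → 1 ≤ n →
      ∏ k ∈ Finset.Ioc n (2 * n), g k ≤ Real.exp (4 * K * K) := by
    intro n hn hn' hn1
    have hn2 : 2 * (K - m) ≤ n := hn₀.trans (Nat.cast_le.2 hn')
    have hn3 : (1 : ℝ) ≤ n := by exact_mod_cast hn1
    calc ∏ k ∈ Finset.Ioc n (2 * n), g k
        ≤ ∏ k ∈ Finset.Ioc n (2 * n), Real.exp (4 * K * K / n) := by
          refine Finset.prod_le_prod (fun k hk => (hg0 (hn.trans (Finset.mem_Ioc.1 hk).1.le)).le)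
            fun k hk => ?_
          have hk' : (n : ℝ) < k := by exact_mod_cast (Finset.mem_Ioc.1 hk).1
          have hx : (K : ℝ) < k + m := by linarith
          have hx' : (n : ℝ) / 2 ≤ k + m - K := by linarith
          have hx0 : 0 < (k : ℝ) + m - K := by linarith
          refine (gammaSecondDiff_le hK hx).trans ?_
          rw [show 4 * (K : ℝ) * K / n = K * (4 * K / n) by ring, Real.exp_nat_mul]
          gcongr
          · exact div_nonneg (by linarith [K.cast_nonneg (α := ℝ)]) hx0.le
          calc ((k : ℝ) + m + K) / (k + m - K) = 2 * K / (k + m - K) + 1 := by field_simp; ring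
            _ ≤ 2 * K / (n / 2) + 1 := by gcongr
            _ = 4 * K / n + 1 := by field_simp; ring
            _ ≤ _ := Real.add_one_le_exp _
      _ = Real.exp (4 * K * K) := by
          rw [Finset.prod_const, Nat.card_Ioc, ← Real.exp_nat_mul, show 2 * n - n = n by omega]
          congr 1
          field_simp
  -- the lower bounds `1 + C / (j + 1)` for `g (M + j + 1)` lead to the harmonic series
  have hden : Filter.Tendsto (fun n => ∏ k ∈ Finset.Ioc N n, g k) Filter.atTop Filter.atTop := by
    obtain ⟨M, hM⟩ := exists_nat_ge (|m| + N + 1)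
    have hM1 : |m| + 1 ≤ M := by linarith [N.cast_nonneg (α := ℝ)]
    have hM2 : (N : ℝ) ≤ M := by linarith [abs_nonneg m]
    have hMN : N ≤ M := by exact_mod_cast hM2
    obtain ⟨hm1, hm2⟩ := abs_le.1 (le_refl |m|)
    have hstep : ∀ j : ℕ, 1 + d ^ 2 / 9 / (2 * M + 1) * (1 / ((j : ℝ) + 1)) ≤ g (M + j + 1) := by
      intro j
      have hx : (1 : ℝ) ≤ ((M + j + 1 : ℕ) : ℝ) + m := by
        push_cast; linarith [j.cast_nonneg (α := ℝ)]
      refine le_trans ?_ (one_add_div_le_gammaSecondDiff (hlt (by omega)) hx)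
      rw [← div_eq_mul_one_div, div_div (d ^ 2 / 9)]
      gcongr
      push_cast
      nlinarith [mul_nonneg (M.cast_nonneg (α := ℝ)) (j.cast_nonneg (α := ℝ))]
    have hle : ∀ j : ℕ, d ^ 2 / 9 / (2 * M + 1) * ∑ i ∈ Finset.range j, 1 / ((i : ℝ) + 1) ≤
        ∏ k ∈ Finset.Ioc N (M + j), g k := by
      intro j
      induction j with
      | zero => simpa using zero_le_one.trans (hprod1 N M le_rfl)
      | succ j ih =>
        have h1 := hprod1 N (M + j) le_rfl
        have h2 : 0 ≤ d ^ 2 / 9 / (2 * M + 1) * (1 / ((j : ℝ) + 1)) := by positivity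
        rw [Finset.sum_range_succ, mul_add, ← add_assoc,
          Finset.prod_Ioc_succ_top (by omega : N ≤ M + j)]
        nlinarith [hstep j]
    have hc : 0 < d ^ 2 / 9 / (2 * (M : ℝ) + 1) := by positivity
    have h := Filter.tendsto_atTop_mono hle
      (Real.tendsto_sum_range_one_div_nat_succ_atTop.const_mul_atTop hc)
    rw [← Filter.tendsto_add_atTop_iff_nat M]
    simpa only [add_comm M] using h
  have hlim : Filter.Tendsto (fun n => Real.exp (4 * K * K) / ∏ k ∈ Finset.Ioc N n, g k)
      Filter.atTop (nhds 0) := hden.const_div_atTop _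
  refine squeeze_zero' ?_ ?_ hlim
  · filter_upwards with n
    refine Finset.prod_nonneg fun l hl => ?_
    have h1 : (N : ℝ) + 1 ≤ l := by exact_mod_cast (Finset.mem_Ioc.1 hl).1
    have h2 : (1 : ℝ) ≤ l := by linarith [N.cast_nonneg (α := ℝ)]
    have q1 := gammaSecondDiff_pos (d := d) (x := 2 * l + m) (by linarith)
    have q2 := gammaSecondDiff_pos (d := d) (x := 2 * l - 1 + m) (by linarith)
    positivity
  · filter_upwards [Filter.eventually_ge_atTop (max N (max n₀ 1))] with n hn
    have hnN : N ≤ n := by omega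
    have hp1 := hprod1 N n le_rfl
    have hp2 := hprod1 N (2 * N) le_rfl
    rw [le_div_iff₀ (by linarith)]
    refine le_trans ?_ (hnum n hnN (by omega) (by omega))
    rw [← htel n hnN]
    have hnn : 0 ≤ ∏ l ∈ Finset.Ioc N n, (gammaSecondDiff d (2 * l + m) *
      gammaSecondDiff d (2 * l - 1 + m) / gammaSecondDiff d (l + m) ^ 2) := by
      refine Finset.prod_nonneg fun l hl => ?_
      have h1 : (N : ℝ) + 1 ≤ l := by exact_mod_cast (Finset.mem_Ioc.1 hl).1
      have h2 : (1 : ℝ) ≤ l := by linarith [N.cast_nonneg (α := ℝ)]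
      have q1 := gammaSecondDiff_pos (d := d) (x := 2 * l + m) (by linarith)
      have q2 := gammaSecondDiff_pos (d := d) (x := 2 * l - 1 + m) (by linarith)
      positivity
    gcongr
    nlinarith

/-! ### Corner densities and their affinities -/

lemma continuous_detOnePlus {n : ℕ} : Continuous (detOnePlus : Mat n → ℝ) := continuous_rectDet

lemma detOnePlus_pos {n : ℕ} (Z : Mat n) : 0 < detOnePlus Z := rectDet_pos Z

lemma measurable_ofReal_detOnePlus_rpow {n : ℕ} (e : ℝ) :
    Measurable fun Z : Mat n => ENNReal.ofReal (detOnePlus Z ^ e) :=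
  (continuous_detOnePlus.measurable.pow_const e).ennreal_ofReal

lemma measurable_corner (n : ℕ) : Measurable (corner n) := by
  unfold corner; fun_prop

lemma gammaRatio_pos {s : ℝ} {l : ℕ} (hl : 1 ≤ l) (h : 0 < (l : ℝ) + s) : 0 < gammaRatio s l := by
  have hl' : (1 : ℝ) ≤ l := by exact_mod_cast hl
  have g1 := Real.Gamma_pos_of_pos (show 0 < 2 * (l : ℝ) + s by linarith)
  have g2 := Real.Gamma_pos_of_pos (show 0 < 2 * (l : ℝ) - 1 + s by linarith)
  have g3 := Real.Gamma_pos_of_pos h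
  unfold gammaRatio
  positivity

/-- In the finite and in the infinite case alike, the corner densities from a level `N > -s` on
have constants that are positive and change by the same factors `π^(-(2l-1)) gammaRatio s l`. -/
lemma IsPickrellMeasure.exists_map_corner_eq {s : ℝ} {μ : Measure InfMat}
    (h : IsPickrellMeasure s μ) {N : ℕ} (hN : 1 ≤ N) (hNs : 0 < (N : ℝ) + s) :
    ∃ κ : ℝ, 0 < κ ∧ ∀ n, N ≤ n → μ.map (corner n) =
      ENNReal.ofReal (κ * ∏ l ∈ Finset.Ioc N n, gammaRatio s l / Real.pi ^ (2 * l - 1)) •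
        unnormalized n s := by
  obtain h | ⟨c, h⟩ := h
  · refine ⟨finiteConst s N, ?_, fun n hn => ?_⟩
    · refine mul_pos (by positivity) (Finset.prod_pos fun l hl => ?_)
      have hl1 := (Finset.mem_Icc.1 hl).1
      have : (1 : ℝ) ≤ l := by exact_mod_cast hl1
      exact gammaRatio_pos hl1 (by linarith [h.neg_one_lt])
    · rw [h.map_corner n (hN.trans hn)]
      congr 2
      induction n, hn using Nat.le_induction with
      | base => simp
      | succ n hn ih =>
        rw [Finset.prod_Ioc_succ_top (by omega), ← mul_assoc, ← ih, finiteConst, finiteConst,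
          Finset.prod_Icc_succ_top (by omega),
          show (n + 1) ^ 2 = n ^ 2 + (2 * (n + 1) - 1) by
            rw [show 2 * (n + 1) - 1 = 2 * n + 1 by omega]; ring, pow_add]
        field_simp
  · have hle : firstLevel s ≤ N := Nat.sInf_le ⟨hN, hNs⟩
    have hmem : firstLevel s ∈ {n : ℕ | 1 ≤ n ∧ 0 < (n : ℝ) + s} := Nat.sInf_mem ⟨N, hN, hNs⟩
    refine ⟨c * infiniteConst s N, mul_pos h.pos (Finset.prod_pos fun l hl => ?_), fun n hn => ?_⟩
    · have hl1 := (Finset.mem_Icc.1 hl).1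
      have hl2 : (firstLevel s : ℝ) ≤ l := by exact_mod_cast hl1
      exact mul_pos (by positivity) (gammaRatio_pos (hmem.1.trans hl1) (by linarith [hmem.2]))
    · have hn' : (N : ℝ) ≤ n := by exact_mod_cast hn
      rw [h.map_corner n (hN.trans hn) (by linarith), mul_assoc]
      congr 3
      clear hn'
      induction n, hn using Nat.le_induction with
      | base => simp
      | succ n hn ih =>
        rw [Finset.prod_Ioc_succ_top (by omega), ← mul_assoc, ← ih, infiniteConst, infiniteConst,
          Finset.prod_Icc_succ_top (by omega), Real.rpow_neg Real.pi_pos.le,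
          show 2 * ((n + 1 : ℕ) : ℝ) - 1 = ((2 * (n + 1) - 1 : ℕ) : ℝ) by
            rw [show 2 * (n + 1) - 1 = 2 * n + 1 by omega]; push_cast; ring, Real.rpow_natCast]
        field_simp

lemma map_corner_apply {μ : Measure InfMat} {n : ℕ} {s k : ℝ}
    (h : μ.map (corner n) = ENNReal.ofReal k • unnormalized n s) {S : Set (Mat n)}
    (hS : MeasurableSet S) :
    μ (corner n ⁻¹' S) =
      ENNReal.ofReal k * ∫⁻ Z in S, ENNReal.ofReal (detOnePlus Z ^ (-2 * (n : ℝ) - s)) := by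
  rw [← Measure.map_apply (measurable_corner n) hS, h, Measure.smul_apply, unnormalized,
    withDensity_apply _ hS, smul_eq_mul]

/-- The smaller of two positive numbers `kᵢ D ^ eᵢ` is at most their geometric mean. -/
lemma mul_rpow_le_sqrt_mul_rpow {k₁ k₂ D e₁ e₂ : ℝ} (hk₁ : 0 < k₁) (hk₂ : 0 < k₂) (hD : 0 < D)
    (h : k₁ * D ^ e₁ ≤ k₂ * D ^ e₂) :
    k₁ * D ^ e₁ ≤ √(k₁ * k₂) * D ^ ((e₁ + e₂) / 2) := by
  have h1 : √(k₁ * k₂) * D ^ ((e₁ + e₂) / 2) = √((k₁ * D ^ e₁) * (k₂ * D ^ e₂)) := by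
    rw [show (k₁ * D ^ e₁) * (k₂ * D ^ e₂) = (k₁ * k₂) * D ^ (e₁ + e₂) by
      rw [Real.rpow_add hD]; ring, Real.sqrt_mul (x := k₁ * k₂) (by positivity),
      Real.sqrt_eq_rpow (D ^ (e₁ + e₂)),
      ← Real.rpow_mul hD.le]
    congr 2
    ring
  rw [h1]
  refine Real.le_sqrt_of_sq_le ?_
  rw [sq]
  gcongr

lemma setLIntegral_le_affinity {n : ℕ} {k₁ k₂ s₁ s₂ : ℝ} (hk₁ : 0 < k₁) (hk₂ : 0 < k₂)
    {S T : Set (Mat n)} (hS : MeasurableSet S) (hST : S ⊆ T)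
    (h : ∀ Z ∈ S, k₁ * detOnePlus Z ^ (-2 * (n : ℝ) - s₁) ≤
      k₂ * detOnePlus Z ^ (-2 * (n : ℝ) - s₂)) :
    ENNReal.ofReal k₁ * ∫⁻ Z in S, ENNReal.ofReal (detOnePlus Z ^ (-2 * (n : ℝ) - s₁)) ≤
      ENNReal.ofReal √(k₁ * k₂) *
        ∫⁻ Z in T, ENNReal.ofReal (detOnePlus Z ^ (-2 * (n : ℝ) - (s₁ + s₂) / 2)) := by
  rw [← lintegral_const_mul _ (measurable_ofReal_detOnePlus_rpow _),
    ← lintegral_const_mul _ (measurable_ofReal_detOnePlus_rpow _)]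
  refine (setLIntegral_mono' hS fun Z hZ => ?_).trans (lintegral_mono_set hST)
  rw [← ENNReal.ofReal_mul hk₁.le, ← ENNReal.ofReal_mul (by positivity)]
  refine ENNReal.ofReal_le_ofReal ?_
  convert mul_rpow_le_sqrt_mul_rpow hk₁ hk₂ (detOnePlus_pos Z) (h Z hZ) using 3
  ring

/-- A measure below both `μ₁` and `μ₂` is bounded by the affinity (the integral of the geometric
mean) of their corner densities: each of the two densities is at most the geometric mean on the
set where it is the smaller one. -/
lemma measure_preimage_corner_le_affinity {μ₁ μ₂ ρ : Measure InfMat} {n : ℕ} {k₁ k₂ s₁ s₂ : ℝ}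
    (hk₁ : 0 < k₁) (hk₂ : 0 < k₂)
    (h₁ : μ₁.map (corner n) = ENNReal.ofReal k₁ • unnormalized n s₁)
    (h₂ : μ₂.map (corner n) = ENNReal.ofReal k₂ • unnormalized n s₂)
    (hρ₁ : ρ ≤ μ₁) (hρ₂ : ρ ≤ μ₂) {S : Set (Mat n)} (hS : MeasurableSet S) :
    ρ (corner n ⁻¹' S) ≤ 2 * (ENNReal.ofReal √(k₁ * k₂) *
      ∫⁻ Z in S, ENNReal.ofReal (detOnePlus Z ^ (-2 * (n : ℝ) - (s₁ + s₂) / 2))) := by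
  set A : Set (Mat n) := {Z | k₁ * detOnePlus Z ^ (-2 * (n : ℝ) - s₁) ≤
    k₂ * detOnePlus Z ^ (-2 * (n : ℝ) - s₂)} with hA
  have hAm : MeasurableSet A := measurableSet_le
    ((continuous_detOnePlus.measurable.pow_const _).const_mul _)
    ((continuous_detOnePlus.measurable.pow_const _).const_mul _)
  have hsplit : corner n ⁻¹' S = corner n ⁻¹' (S ∩ A) ∪ corner n ⁻¹' (S \ A) := by
    rw [← Set.preimage_union, Set.inter_union_sdiff]
  rw [hsplit, two_mul]
  refine (measure_union_le _ _).trans (add_le_add ?_ ?_)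
  · refine (hρ₁ _).trans ?_
    rw [map_corner_apply h₁ (hS.inter hAm)]
    exact setLIntegral_le_affinity hk₁ hk₂ (hS.inter hAm) Set.inter_subset_left fun Z hZ => hZ.2
  · refine (hρ₂ _).trans ?_
    rw [map_corner_apply h₂ (hS.diff hAm), mul_comm k₁ k₂, add_comm s₁ s₂]
    exact setLIntegral_le_affinity hk₂ hk₁ (hS.diff hAm) Set.sdiff_subset
      fun Z hZ => (not_le.1 hZ.2).le

/-- The upper left `N × N` corner of an `n × n` matrix. -/
def subCorner {N n : ℕ} (h : N ≤ n) (Z : Mat n) : Mat N :=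
  fun i j => Z (Fin.castLE h i) (Fin.castLE h j)

lemma measurable_subCorner {N n : ℕ} (h : N ≤ n) : Measurable (subCorner h) := by
  unfold subCorner; fun_prop

/-- Iterated Hua integral over the matrices with upper left `N × N` corner in `Y`. -/
lemma setLIntegral_preimage_subCorner {N n : ℕ} (h : N ≤ n) {s : ℝ} (hs : 0 < (N : ℝ) + s)
    {Y : Set (Mat N)} (hY : MeasurableSet Y) :
    ∫⁻ Z in subCorner h ⁻¹' Y, ENNReal.ofReal (detOnePlus Z ^ (-2 * (n : ℝ) - s)) =
      ENNReal.ofReal (∏ l ∈ Finset.Ioc N n, Real.pi ^ (2 * l - 1) / gammaRatio s l) *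
        ∫⁻ Z in Y, ENNReal.ofReal (detOnePlus Z ^ (-2 * (N : ℝ) - s)) := by
  induction n, h using Nat.le_induction with
  | base =>
    simp [show subCorner le_rfl ⁻¹' Y = Y from rfl]
  | succ n h ih =>
    have hn : (N : ℝ) ≤ n := by exact_mod_cast h
    have hF : Measurable ((subCorner h ⁻¹' Y).indicator (1 : Mat n → ℝ≥0∞)) :=
      measurable_one.indicator (measurable_subCorner h hY)
    have key := lintegral_dropLast (s := s) (n := n) (by push_cast; linarith) hF
    have hind : ∀ (k : ℕ) (T : Set (Mat k)), MeasurableSet T → ∀ f : Mat k → ℝ≥0∞,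
        ∫⁻ Z in T, f Z = ∫⁻ Z, T.indicator 1 Z * f Z := by
      intro k T hT f
      rw [← lintegral_indicator hT]
      refine lintegral_congr fun Z => ?_
      by_cases hZ : Z ∈ T <;> simp [hZ]
    rw [hind _ _ (measurable_subCorner _ hY)]
    rw [hind _ _ (measurable_subCorner _ hY)] at ih
    refine key.trans ?_
    rw [ih, ← mul_assoc, ← ENNReal.ofReal_mul, Finset.prod_Ioc_succ_top h,
      show 2 * (n + 1) - 1 = 2 * n + 1 by omega, mul_comm (∏ l ∈ _, _)]
    have := gammaRatio_pos (s := s) (l := n + 1) (by omega) (by push_cast; linarith)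
    positivity

/-- The square of the factor by which the affinity for the parameters `m ± d` changes at the
level `l`. -/
lemma gammaRatio_mul_div_sq {m d : ℝ} {l : ℕ} (hl : 1 ≤ l) (h : |d| < l + m) :
    gammaRatio (m + d) l * gammaRatio (m - d) l / gammaRatio m l ^ 2 =
      gammaSecondDiff d (2 * l + m) * gammaSecondDiff d (2 * l - 1 + m) /
        gammaSecondDiff d (l + m) ^ 2 := by
  have hl' : (1 : ℝ) ≤ l := by exact_mod_cast hl
  obtain ⟨h1, h2⟩ := abs_lt.1 h
  have g1 := Real.Gamma_pos_of_pos (show 0 < 2 * (l : ℝ) + m by linarith)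
  have g2 := Real.Gamma_pos_of_pos (show 0 < 2 * (l : ℝ) - 1 + m by linarith)
  have g3 := Real.Gamma_pos_of_pos (show 0 < (l : ℝ) + m by linarith)
  have g4 := Real.Gamma_pos_of_pos (show 0 < (l : ℝ) + m + d by linarith)
  have g5 := Real.Gamma_pos_of_pos (show 0 < (l : ℝ) + m - d by linarith)
  simp only [gammaRatio, gammaSecondDiff, ← add_assoc, ← add_sub_assoc]
  field_simp

lemma setLIntegral_detOnePlus_rpow_lt_top {N : ℕ} (e : ℝ) {Y : Set (Mat N)} (hY : IsCompact Y) :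
    ∫⁻ Z in Y, ENNReal.ofReal (detOnePlus Z ^ e) < ∞ := by
  have hc : Continuous fun Z : Mat N => detOnePlus Z ^ e :=
    continuous_detOnePlus.rpow_const fun Z => Or.inl (detOnePlus_pos Z).ne'
  exact (hc.continuousOn.integrableOn_compact hY).lintegral_lt_top

end Pickrell

end

theorem mainTheorem11 (s₁ s₂ : ℝ) (hs : s₁ ≠ s₂)
    (μ₁ μ₂ : MeasureTheory.Measure Pickrell.InfMat)
    (h₁ : Pickrell.IsPickrellMeasure s₁ μ₁) (h₂ : Pickrell.IsPickrellMeasure s₂ μ₂) :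
    μ₁.MutuallySingular μ₂ := by
  open Pickrell in
  -- from the level `N` on, both measures have corner densities and Hua's integral is finite for
  -- every parameter between `s₁` and `s₂`
  obtain ⟨N, hN⟩ := exists_nat_gt (max (max (-s₁) (-s₂)) 0)
  simp only [max_lt_iff] at hN
  obtain ⟨⟨hN1, hN2⟩, hN0⟩ := hN
  have hN1' : 1 ≤ N := by exact_mod_cast hN0
  obtain ⟨κ₁, hκ₁, hμ₁⟩ := h₁.exists_map_corner_eq hN1' (by linarith)
  obtain ⟨κ₂, hκ₂, hμ₂⟩ := h₂.exists_map_corner_eq hN1' (by linarith)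
  set m : ℝ := (s₁ + s₂) / 2 with hm
  set d : ℝ := (s₁ - s₂) / 2 with hd
  have hd0 : d ≠ 0 := div_ne_zero (sub_ne_zero.2 hs) two_ne_zero
  have hdm : |d| < N + m := by rw [abs_lt]; constructor <;> linarith
  have hm1 : m + d = s₁ := by ring
  have hm2 : m - d = s₂ := by ring
  -- a common minorant `ρ` vanishes on the preimages of all balls
  refine Measure.mutuallySingular_of_disjoint fun ρ hρ₁ hρ₂ => ?_
  have hball : ∀ R : ℕ, ρ (corner N ⁻¹' Metric.closedBall 0 R) = 0 := by
    intro R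
    set Y : Set (Mat N) := Metric.closedBall 0 R with hY
    have hYm : MeasurableSet Y := measurableSet_closedBall
    set I := ∫⁻ Z in Y, ENNReal.ofReal (detOnePlus Z ^ (-2 * (N : ℝ) - m)) with hI
    have hItop : I ≠ ∞ :=
      (setLIntegral_detOnePlus_rpow_lt_top _ (isCompact_closedBall _ _)).ne
    set T : ℕ → ℝ := fun n => ∏ l ∈ Finset.Ioc N n, (gammaSecondDiff d (2 * l + m) *
      gammaSecondDiff d (2 * l - 1 + m) / gammaSecondDiff d (l + m) ^ 2) with hT
    have hT0 : Filter.Tendsto T Filter.atTop (nhds 0) := tendsto_prod_gammaSecondDiff hd0 hdm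
    have hbound : ∀ n, N ≤ n →
        ρ (corner N ⁻¹' Y) ≤ 2 * (ENNReal.ofReal (√(κ₁ * κ₂) * √(T n)) * I) := by
      intro n hn
      have hpos : ∀ s : ℝ, 0 < N + s → ∀ l ∈ Finset.Ioc N n, 0 < gammaRatio s l := by
        intro s hs l hl
        have hl1 := (Finset.mem_Ioc.1 hl).1
        have : (N : ℝ) < l := by exact_mod_cast hl1
        exact gammaRatio_pos (by omega) (by linarith)
      have hp1 : 0 < ∏ l ∈ Finset.Ioc N n, gammaRatio s₁ l / Real.pi ^ (2 * l - 1) :=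
        Finset.prod_pos fun l hl => div_pos (hpos s₁ (by linarith) l hl) (by positivity)
      have hp2 : 0 < ∏ l ∈ Finset.Ioc N n, gammaRatio s₂ l / Real.pi ^ (2 * l - 1) :=
        Finset.prod_pos fun l hl => div_pos (hpos s₂ (by linarith) l hl) (by positivity)
      have hp3 : 0 < ∏ l ∈ Finset.Ioc N n, Real.pi ^ (2 * l - 1) / gammaRatio m l :=
        Finset.prod_pos fun l hl =>
          div_pos (by positivity) (hpos m (by linarith [abs_nonneg d]) l hl)
      have h := measure_preimage_corner_le_affinity (mul_pos hκ₁ hp1) (mul_pos hκ₂ hp2)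
        (hμ₁ n hn) (hμ₂ n hn) hρ₁ hρ₂ (measurable_subCorner hn hYm)
      rw [setLIntegral_preimage_subCorner hn (by linarith [abs_nonneg d]) hYm, ← hm,
        ← mul_assoc (ENNReal.ofReal _), ← ENNReal.ofReal_mul (by positivity)] at h
      refine h.trans (le_of_eq ?_)
      congr 3
      rw [mul_mul_mul_comm, Real.sqrt_mul (by positivity), mul_assoc]
      congr 1
      -- the powers of `π` cancel, and the gamma factors combine under one square root
      rw [← Real.sqrt_sq hp3.le, ← Real.sqrt_mul (by positivity)]
      congr 1
      rw [← Finset.prod_pow, ← Finset.prod_mul_distrib, ← Finset.prod_mul_distrib]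
      refine Finset.prod_congr rfl fun l hl => ?_
      have hl1 := (Finset.mem_Ioc.1 hl).1
      have hl2 : (N : ℝ) < l := by exact_mod_cast hl1
      rw [← gammaRatio_mul_div_sq (by omega) (by linarith), hm1, hm2]
      field_simp
    have hlim : Filter.Tendsto
        (fun n => 2 * (ENNReal.ofReal (√(κ₁ * κ₂) * √(T n)) * I)) Filter.atTop (nhds 0) := by
      have h1 : Filter.Tendsto (fun n => √(κ₁ * κ₂) * √(T n)) Filter.atTop (nhds 0) := by
        simpa using hT0.sqrt.const_mul √(κ₁ * κ₂)
      have h2 := ENNReal.Tendsto.mul_const (b := I) (ENNReal.tendsto_ofReal h1) (Or.inr hItop)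
      have h3 := ENNReal.Tendsto.const_mul (a := 2) h2 (Or.inr (by simp))
      simpa using h3
    exact le_antisymm (ge_of_tendsto hlim (Filter.eventually_atTop.2 ⟨N, hbound⟩)) zero_le
  refine (Measure.measure_univ_eq_zero.1 ?_).le
  rw [← Set.preimage_univ (f := corner N), ← Metric.iUnion_closedBall_nat 0, Set.preimage_iUnion]
  exact measure_iUnion_null hball
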